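/- All groups are finite. A formation $\mathfrak F$ is an isomorphism-closed class of groups that is closed under quotients and such that $G/M,\,G/N\in\mathfrak F$ implies $G/(M\cap N)\in\mathfrak F$ for all $M,N\lhd G$. It is saturated if $G/\Phi(G)\in\mathfrak F$ implies $G\in\mathfrak F$, where $\Phi(G)$ is the Frattini subgroup. Write $K<\!\cdot\,L$ if $K$ is a maximal subgroup of $L$, and $K_L$ for the core of $K$ in $L$. A subgroup $H$ of $G$ is $\mathfrak F$-subnormal in $G$ if $H=G$ or there is a chain $H=H_0<\!\cdot\,H_1<\!\cdot\,\cdots<\!\cdot\,H_n=G$ with $H_i/(H_{i-1})_{H_i}\in\mathfrak F$ for all $i$. It is $\mathfrak F$-abnormal in $G$ if $L/K_L\notin\mathfrak F$ whenever $H\le K<\!\cdot\,L\le G$. A formation $\mathfrak F$ is superradical if it is closed under subnormal subgroups and every group $G=AB$, where $A,B\in\mathfrak F$ are $\mathfrak F$-subnormal subgroups of $G$, belongs to $\mathfrak F$. The $\mathfrak F$-residual $G^{\mathfrak F}$ is the intersection of all $N\lhd G$ with $G/N\in\mathfrak F$. A subgroup $H$ is an $\mathfrak F$-projector of $G$ if,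 for every $N\lhd G$, $HN/N$ is maximal (under inclusion) among the subgroups of $G/N$ that belong to $\mathfrak F$. A primary cyclic subgroup is a cyclic subgroup of prime power order. **Corollary.** Let $\mathfrak F$ be a subgroup-closed saturated superradical formation containing all nilpotent groups, and let $G$ be a soluble group with $G\notin\mathfrak F$. The following statements are equivalent. 1. Every primary cyclic subgroup of $G$ is $\mathfrak F$-subnormal or $\mathfrak F$-abnormal in $G$. 2. Every proper subgroup of $G$ is $\mathfrak F$-subnormal or $\mathfrak F$-abnormal in $G$. 3. There are a prime $p$ dividing $|G|$ and an element $x\in G$ such that $G=G'\rtimes\langle x\rangle$, where $\langle x\rangle$ is a Sylow $p$-subgroup and an $\mathfrak F$-projector of $G$, $G'=G^{\mathfrak F}$, and $G'\langle x^p\rangle\in\mathfrak F$. -/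

import Mathlib

universe u

/-- A class of groups (in a fixed universe). Only its finite members matter: every closure
property below is required for finite groups only. -/
abbrev GroupClass := (G : Type u) → [Group G] → Prop

namespace GroupClass

/-- A formation of finite groups: an isomorphism-closed class of finite groups closed under
quotients and such that `G ⧸ M ∈ 𝔉` and `G ⧸ N ∈ 𝔉` imply `G ⧸ (M ⊓ N) ∈ 𝔉`. -/
structure IsFormation (𝔉 : GroupClass.{u}) : Prop where
  iso : ∀ (G H : Type u) [Group G] [Group H] [Finite G], (G ≃* H) → 𝔉 G → 𝔉 H
  quotient : ∀ (G : Type u) [Group G] [Finite G] (N : Subgroup G) [N.Normal],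
    𝔉 G → 𝔉 (G ⧸ N)
  subdirect : ∀ (G : Type u) [Group G] [Finite G] (M N : Subgroup G) [M.Normal] [N.Normal],
    𝔉 (G ⧸ M) → 𝔉 (G ⧸ N) → 𝔉 (G ⧸ (M ⊓ N))

/-- Closure under subgroups. -/
def SubgroupClosed (𝔉 : GroupClass.{u}) : Prop :=
  ∀ (G : Type u) [Group G] [Finite G] (H : Subgroup G), 𝔉 G → 𝔉 H

/-- Closure under subnormal subgroups. -/
def SubnormalSubgroupClosed (𝔉 : GroupClass.{u}) : Prop :=
  ∀ (G : Type u) [Group G] [Finite G] (H : Subgroup G), H.IsSubnormal → 𝔉 G → 𝔉 H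

/-- Saturation: `G ⧸ Φ(G) ∈ 𝔉` implies `G ∈ 𝔉`, where `Φ(G)` is the Frattini subgroup. -/
def Saturated (𝔉 : GroupClass.{u}) : Prop :=
  ∀ (G : Type u) [Group G] [Finite G], 𝔉 (G ⧸ frattini G) → 𝔉 G

/-- The class contains all (finite) nilpotent groups. -/
def ContainsNilpotent (𝔉 : GroupClass.{u}) : Prop :=
  ∀ (G : Type u) [Group G] [Finite G], Group.IsNilpotent G → 𝔉 G

/-- `K` is a maximal subgroup of `L` and the
quotient of `L` by the core `K_L` of `K` in `L` belongs to `𝔉`. -/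
def IsFNormalMaximal (𝔉 : GroupClass.{u}) {G : Type u} [Group G] (K L : Subgroup G) : Prop :=
  K ⋖ L ∧ 𝔉 (L ⧸ (K.subgroupOf L).normalCore)

/-- `H` is `𝔉`-subnormal in `G`: there is a (possibly trivial) chain
`H = H₀ ⋖ H₁ ⋖ ⋯ ⋖ Hₙ = G` of subgroups, each maximal in the next, such that the quotient of
`Hᵢ` by the core of `Hᵢ₋₁` in `Hᵢ` is in `𝔉` for all `i`. -/
def IsFSubnormal (𝔉 : GroupClass.{u}) {G : Type u} [Group G] (H : Subgroup G) : Prop :=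
  Relation.ReflTransGen (IsFNormalMaximal 𝔉) H ⊤

/-- `H` is `𝔉`-abnormal in `G`: `L / K_L ∉ 𝔉` whenever `H ≤ K ⋖ L ≤ G`. -/
def IsFAbnormal (𝔉 : GroupClass.{u}) {G : Type u} [Group G] (H : Subgroup G) : Prop :=
  ∀ K L : Subgroup G, H ≤ K → K ⋖ L → ¬ 𝔉 (L ⧸ (K.subgroupOf L).normalCore)

/-- A superradical class: closed under subnormal subgroups, and every finite group `G = AB`
with `A`, `B` both `𝔉`-subnormal in `G` and belonging to `𝔉` belongs to `𝔉`. -/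
structure IsSuperradical (𝔉 : GroupClass.{u}) : Prop where
  subnormalClosed : 𝔉.SubnormalSubgroupClosed
  product : ∀ (G : Type u) [Group G] [Finite G] (A B : Subgroup G),
    (∀ g : G, ∃ a ∈ A, ∃ b ∈ B, g = a * b) →
    𝔉.IsFSubnormal A → 𝔉.IsFSubnormal B → 𝔉 A → 𝔉 B → 𝔉 G

/-- The `𝔉`-residual: the intersection of all normal subgroups `N` with `G ⧸ N ∈ 𝔉`. -/
def residual (𝔉 : GroupClass.{u}) (G : Type u) [Group G] : Subgroup G :=
  sInf {N : Subgroup G | ∃ _ : N.Normal, 𝔉 (G ⧸ N)}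

/-- `H` is an `𝔉`-projector of `G`: for every normal subgroup `N` of `G`, the image `HN/N` of
`H` in `G ⧸ N` is maximal among the subgroups of `G ⧸ N` that belong to `𝔉`. -/
def IsProjector (𝔉 : GroupClass.{u}) {G : Type u} [Group G] (H : Subgroup G) : Prop :=
  ∀ (N : Subgroup G) [N.Normal],
    Maximal (fun K : Subgroup (G ⧸ N) => 𝔉 K) (H.map (QuotientGroup.mk' N))

end GroupClass

/-- A primary cyclic subgroup: a cyclic subgroup whose order is a power of a prime. -/
def Subgroup.IsPrimaryCyclic {G : Type u} [Group G] (H : Subgroup G) : Prop :=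
  IsCyclic H ∧ ∃ p : ℕ, p.Prime ∧ ∃ n : ℕ, Nat.card H = p ^ n

/-- `G = A ⋊ B` internally: `A` is normal in `G`, `G = AB` and `A ∩ B = 1`. -/
def Subgroup.IsInternalSemidirect {G : Type u} [Group G] (A B : Subgroup G) : Prop :=
  A.Normal ∧ A.IsComplement' B

/-!
Two opposite principles carry the proof. If `L` has a homomorphism to a group of `𝔉` whose kernel
lies in `H`, then `H` is `𝔉`-subnormal in `L` (`reflTransGen_of_ker_le`), whereas if `K` contains
an `𝔉`-abnormal subgroup and such a kernel, then `K = L` (`IsFAbnormal.eq_of_ker_le`).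

The latter makes an `𝔉`-abnormal subgroup of `p`-power order self-normalizing, a Sylow subgroup
(Sylow subgroups are nilpotent, hence in `𝔉`) and a supplement of both `G'` and `G^𝔉`. If it is
cyclic, Burnside's transfer theorem therefore shows that it is a complement of `G'`. Moreover, a
subgroup of a proper subgroup containing `G'` is never `𝔉`-abnormal. By superradicality a soluble
group all of whose primary cyclic subgroups are `𝔉`-subnormal lies in `𝔉`
(`mem_of_forall_isFSubnormal`). So if every primary cyclic subgroup of `G ∉ 𝔉` is `𝔉`-subnormal
or `𝔉`-abnormal, some cyclic Sylow subgroup `⟨x⟩` is `𝔉`-abnormal, while `G'⟨x ^ p⟩` lies in `𝔉`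
(`exists_isSplitting`).

Conversely, suppose that `G = G' ⋊ ⟨x⟩` is as in the third statement. Subgroups of
`M = G'⟨x ^ p⟩` are `𝔉`-subnormal since `M ∈ 𝔉`. A subgroup not contained in `M` supplements `G'`,
so its order is divisible by that of `⟨x⟩`; it is `𝔉`-abnormal, since saturation provides
supplements in `𝔉` of normal subgroups with quotient in `𝔉` (`exists_supplement_mem`), and by the
projector condition the only members of `𝔉` containing a conjugate of `⟨x⟩` are the conjugates
themselves (`isFAbnormal_of_dvd_card`, `IsProjector.card_eq`).
-/

namespace GroupClass

variable {𝔉 : GroupClass.{u}} {G : Type u} [Group G]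

/-! ### Quotients in the class -/

/-- For a subgroup-closed formation, homomorphisms into groups of the class certify
that quotients lie in the class. -/
theorem quotient_mem_of_ker_le (hform : 𝔉.IsFormation) (hsub : 𝔉.SubgroupClosed)
    {Q : Type u} [Group Q] [Finite Q] (hQ : 𝔉 Q) (φ : G →* Q) (N : Subgroup G) [N.Normal]
    (hN : φ.ker ≤ N) : 𝔉 (G ⧸ N) := by
  have h1 : 𝔉 (G ⧸ φ.ker) := hform.iso _ _ (QuotientGroup.quotientKerEquivRange φ).symm
    (hsub Q φ.range hQ)
  exact hform.iso _ _ (QuotientGroup.quotientQuotientEquivQuotient φ.ker N hN)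
    (hform.quotient _ _ h1)

theorem map_mem [Finite G] (hform : 𝔉.IsFormation) {H : Type u} [Group H] {f : G →* H}
    (hf : Function.Injective f) {K : Subgroup G} (hK : 𝔉 K) : 𝔉 (K.map f) :=
  hform.iso _ _ (K.equivMapOfInjective f hf) hK

theorem abelianization_mem (hnil : 𝔉.ContainsNilpotent) (L : Type u) [Group L] [Finite L] :
    𝔉 (Abelianization L) :=
  hnil _ inferInstance

theorem mem_of_isCyclic [Finite G] (hnil : 𝔉.ContainsNilpotent) (h : IsCyclic G) : 𝔉 G := by
  let := h.commGroup
  exact hnil G inferInstance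

theorem mem_of_isPGroup [Finite G] (hnil : 𝔉.ContainsNilpotent) {p : ℕ} [Fact p.Prime]
    (h : IsPGroup p G) : 𝔉 G :=
  hnil _ h.isNilpotent

/-! ### Subnormality and abnormality with respect to the class -/

/-- If `L` has a quotient in the class by a subgroup of `H`, then every maximal chain from `H` to
`L` witnesses subnormality. The quotient is given by a homomorphism, so that it restricts to the
terms of the chain. -/
theorem reflTransGen_of_ker_le [Finite G] (hform : 𝔉.IsFormation) (hsub : 𝔉.SubgroupClosed)
    {Q : Type u} [Group Q] [Finite Q] (hQ : 𝔉 Q) {H L : Subgroup G} (hHL : H ≤ L)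
    (φ : L →* Q) (hφ : φ.ker ≤ H.subgroupOf L) :
    Relation.ReflTransGen (IsFNormalMaximal 𝔉) H L := by
  induction L using WellFoundedLT.induction with
  | ind L ih =>
    rcases hHL.eq_or_lt with rfl | hlt
    · exact .refl
    · obtain ⟨K, hHK, hK⟩ := exists_le_covBy_of_lt hlt
      refine (ih K hK.lt hHK (φ.comp (Subgroup.inclusion hK.le)) ?_).tail ⟨hK, ?_⟩
      · intro k hk
        exact hφ (x := Subgroup.inclusion hK.le k) hk
      · refine quotient_mem_of_ker_le hform hsub hQ φ _ (Subgroup.normal_le_normalCore.2 ?_)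
        exact fun l hl => hHK (hφ hl)

/-- The counterpart of `reflTransGen_of_ker_le`: above an abnormal subgroup no proper inclusion
`K < L` can contain the kernel of a homomorphism from `L` to a group of the class. -/
theorem IsFAbnormal.eq_of_ker_le [Finite G] (hform : 𝔉.IsFormation) (hsub : 𝔉.SubgroupClosed)
    {Q : Type u} [Group Q] [Finite Q] (hQ : 𝔉 Q) {H K L : Subgroup G}
    (hH : 𝔉.IsFAbnormal H) (hHK : H ≤ K) (hKL : K ≤ L)
    (φ : L →* Q) (hφ : φ.ker ≤ K.subgroupOf L) : K = L := by
  by_contra hne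
  obtain ⟨T, hKT, hT⟩ := exists_le_covBy_of_lt (lt_of_le_of_ne hKL hne)
  refine hH T L (hHK.trans hKT) hT
    (quotient_mem_of_ker_le hform hsub hQ φ _ (Subgroup.normal_le_normalCore.2 ?_))
  exact fun l hl => hKT (hφ hl)

theorem IsFAbnormal.commutator_sup_eq_top [Finite G] (hform : 𝔉.IsFormation)
    (hsub : 𝔉.SubgroupClosed)
    (hnil : 𝔉.ContainsNilpotent) {H : Subgroup G} (hH : 𝔉.IsFAbnormal H) :
    commutator G ⊔ H = ⊤ := by
  refine hH.eq_of_ker_le hform hsub (abelianization_mem hnil G) le_sup_right le_top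
    (Abelianization.of.comp (⊤ : Subgroup G).subtype) fun g hg => ?_
  refine Subgroup.mem_sup_left (?_ : (g : G) ∈ commutator G)
  rw [← Abelianization.ker_of]
  exact hg

theorem IsFAbnormal.eq_of_mem [Finite G] (hform : 𝔉.IsFormation) (hsub : 𝔉.SubgroupClosed)
    {H L : Subgroup G} (hH : 𝔉.IsFAbnormal H) (hHL : H ≤ L) (hL : 𝔉 L) : H = L := by
  refine hH.eq_of_ker_le hform hsub hL le_rfl hHL (MonoidHom.id L) ?_
  intro l hl
  rw [MonoidHom.mem_ker] at hl
  rw [show l = 1 from hl]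
  exact one_mem _

theorem IsFAbnormal.normalizer_le [Finite G] (hform : 𝔉.IsFormation) (hsub : 𝔉.SubgroupClosed)
    (hnil : 𝔉.ContainsNilpotent) {H : Subgroup G} (hH : 𝔉.IsFAbnormal H) :
    Subgroup.normalizer (H : Set G) ≤ H := by
  intro y hy
  -- `H` is normal in `L = H⟨y⟩` with cyclic quotient.
  set L := H ⊔ Subgroup.zpowers y with hL
  have hyL : y ∈ L := Subgroup.mem_sup_right (Subgroup.mem_zpowers y)
  have hLn : L ≤ Subgroup.normalizer (H : Set G) :=
    sup_le Subgroup.le_normalizer (Subgroup.zpowers_le.2 hy)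
  have : (H.subgroupOf L).Normal := (Subgroup.normal_subgroupOf_iff_le_normalizer le_sup_left).2 hLn
  have htop : H.subgroupOf L ⊔ Subgroup.zpowers (⟨y, hyL⟩ : L) = ⊤ := by
    apply Subgroup.map_injective L.subtype_injective
    rw [Subgroup.map_sup, Subgroup.subgroupOf_map_subtype, MonoidHom.map_zpowers,
      ← MonoidHom.range_eq_map, Subgroup.range_subtype, inf_eq_left.2 le_sup_left]
    exact hL.symm
  have hc : commutator L ≤ H.subgroupOf L :=
    Subgroup.Normal.commutator_le_of_self_sup_commutative_eq_top htop inferInstance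
  have := hH.eq_of_ker_le hform hsub (abelianization_mem hnil L) le_rfl
    (le_sup_left : H ≤ L) Abelianization.of (by rwa [Abelianization.ker_of])
  rw [this]
  exact hyL

theorem isFSubnormal_of_commutator_le [Finite G] (hform : 𝔉.IsFormation)
    (hsub : 𝔉.SubgroupClosed)
    (hnil : 𝔉.ContainsNilpotent) {H : Subgroup G} (hH : commutator G ≤ H) :
    𝔉.IsFSubnormal H := by
  refine reflTransGen_of_ker_le hform hsub (abelianization_mem hnil G) le_top
    (Abelianization.of.comp (⊤ : Subgroup G).subtype) fun g hg => hH ?_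
  rw [← Abelianization.ker_of]
  exact hg

theorem reflTransGen_of_mem [Finite G] (hform : 𝔉.IsFormation) (hsub : 𝔉.SubgroupClosed)
    {H L : Subgroup G} (hHL : H ≤ L) (hL : 𝔉 L) :
    Relation.ReflTransGen (IsFNormalMaximal 𝔉) H L := by
  refine reflTransGen_of_ker_le hform hsub hL hHL (MonoidHom.id L) fun l hl => ?_
  rw [show l = 1 from hl]
  exact one_mem _

theorem IsFSubnormal.comap [Finite G] (hform : 𝔉.IsFormation) (hsub : 𝔉.SubgroupClosed)
    {H : Subgroup G} (hH : 𝔉.IsFSubnormal H) {T : Type u} [Group T] [Finite T] (f : T →* G) :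
    𝔉.IsFSubnormal (H.comap f) := by
  induction hH using Relation.ReflTransGen.head_induction_on with
  | refl => exact .refl
  | @head K L hKL _ ih =>
    refine .trans (reflTransGen_of_ker_le hform hsub hKL.2 (Subgroup.comap_mono hKL.1.le)
      ((QuotientGroup.mk' _).comp (f.subgroupComap L)) fun t ht => ?_) ih
    rw [MonoidHom.mem_ker, MonoidHom.comp_apply, QuotientGroup.mk'_apply,
      QuotientGroup.eq_one_iff] at ht
    exact Subgroup.normalCore_le (K.subgroupOf L) ht

/-! ### Supplements in the class -/

/-- A minimal supplement `Y` of `R` meets `R` inside `Φ(Y)`, so saturation puts it in the class. -/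
theorem exists_supplement_mem [Finite G] (hform : 𝔉.IsFormation) (hsub : 𝔉.SubgroupClosed)
    (hsat : 𝔉.Saturated) (R : Subgroup G) [R.Normal] (hR : 𝔉 (G ⧸ R)) :
    ∃ Y : Subgroup G, 𝔉 Y ∧ Y ⊔ R = ⊤ := by
  obtain ⟨Y, hY⟩ := exists_minimal_of_wellFoundedLT (fun Y : Subgroup G => Y ⊔ R = ⊤)
    ⟨⊤, top_sup_eq R⟩
  refine ⟨Y, hsat Y (quotient_mem_of_ker_le hform hsub hR
    ((QuotientGroup.mk' R).comp Y.subtype) _ ?_), hY.prop⟩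
  refine le_iInf₂ fun T hT => ?_
  by_contra hle
  have hsup : T ⊔ ((QuotientGroup.mk' R).comp Y.subtype).ker = ⊤ :=
    hT.2 _ (lt_of_le_of_ne le_sup_left fun h => hle (h ▸ le_sup_right))
  have hker : ((QuotientGroup.mk' R).comp Y.subtype).ker.map Y.subtype ≤ R := by
    rintro _ ⟨y, hy, rfl⟩
    exact (QuotientGroup.eq_one_iff _).1 hy
  have hTR : T.map Y.subtype ⊔ R = ⊤ := by
    refine top_le_iff.1 (hY.prop ▸ sup_le ?_ le_sup_right)
    have := congrArg (Subgroup.map Y.subtype) hsup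
    rw [Subgroup.map_sup, ← MonoidHom.range_eq_map, Subgroup.range_subtype] at this
    exact this.ge.trans (sup_le_sup_left hker _)
  have hYT := hY.le_of_le hTR (Subgroup.map_subtype_le T)
  refine hT.1 (top_le_iff.1 fun y _ => ?_)
  obtain ⟨t, ht, hty⟩ := hYT y.2
  rwa [← Subtype.ext hty]

/-! ### Primary elements -/

/-- A finite group is generated by its elements of prime power order, as these generate
subgroups of order `p ^ k` for all prime powers dividing `|G|`. -/
theorem _root_.Subgroup.eq_top_of_forall_primary_mem [Finite G] (T : Subgroup G)
    (h : ∀ y : G, (Subgroup.zpowers y).IsPrimaryCyclic → y ∈ T) : T = ⊤ := by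
  refine Subgroup.eq_top_of_card_eq _ (Nat.dvd_antisymm T.card_subgroup_dvd_card ?_)
  rw [Nat.dvd_iff_prime_pow_dvd_dvd]
  intro p k hp hk
  have := Fact.mk hp
  obtain ⟨P, hP⟩ := Sylow.exists_subgroup_card_pow_prime p hk
  rw [← hP]
  refine Subgroup.card_dvd_of_le fun y hy => h y ⟨inferInstance, p, hp, ?_⟩
  obtain ⟨m, -, hm⟩ := (Nat.dvd_prime_pow hp).1
    (hP ▸ Subgroup.card_dvd_of_le (Subgroup.zpowers_le.2 hy))
  exact ⟨m, hm⟩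

theorem _root_.Subgroup.IsPrimaryCyclic.map {H : Subgroup G} (hH : H.IsPrimaryCyclic)
    {L : Type u} [Group L] {f : G →* L} (hf : Function.Injective f) :
    (H.map f).IsPrimaryCyclic := by
  obtain ⟨hc, p, hp, n, hn⟩ := hH
  have e := H.equivMapOfInjective f hf
  exact ⟨isCyclic_of_surjective e e.surjective, p, hp, n, by rw [← hn, Nat.card_congr e.toEquiv]⟩

/-- By induction on `|G|` all proper subgroups lie in the class. As `G` is soluble, it has a normal
maximal subgroup `T`; the product of `T` and the cyclic subgroup generated by an element of prime
power order outside `T` is `G`, so superradicality applies. -/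
theorem mem_of_forall_isFSubnormal [Finite G] (hform : 𝔉.IsFormation)
    (hsub : 𝔉.SubgroupClosed)
    (hsuper : 𝔉.IsSuperradical) (hnil : 𝔉.ContainsNilpotent) (hsol : Group.IsSolvable G)
    (h : ∀ H : Subgroup G, H.IsPrimaryCyclic → 𝔉.IsFSubnormal H) : 𝔉 G := by
  induction hn : Nat.card G using Nat.strong_induction_on generalizing G with
  | _ n ih =>
  subst hn
  rcases subsingleton_or_nontrivial G with hG | hG
  · exact hnil G inferInstance
  obtain ⟨T, hT, hcT⟩ := (eq_top_or_exists_le_coatom (commutator G)).resolve_left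
    (Group.IsSolvable.commutator_lt_top_of_nontrivial G).ne
  have : T.Normal := Subgroup.Normal.of_commutator_le _ hcT
  have hlt : Nat.card T < Nat.card G :=
    lt_of_le_of_ne T.card_le_card_group fun h => hT.1 (Subgroup.eq_top_of_card_eq _ h)
  have hTmem : 𝔉 T := by
    refine ih _ hlt inferInstance (fun H hH => ?_) rfl
    have := (h _ (hH.map T.subtype_injective)).comap hform hsub T.subtype
    rwa [Subgroup.comap_map_eq_self_of_injective T.subtype_injective] at this
  obtain ⟨y, hy, hyT⟩ : ∃ y : G, (Subgroup.zpowers y).IsPrimaryCyclic ∧ y ∉ T := by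
    by_contra! hcon
    exact hT.1 (T.eq_top_of_forall_primary_mem hcon)
  have hsup : T ⊔ Subgroup.zpowers y = ⊤ := hT.2 _ <| lt_of_le_of_ne le_sup_left fun h =>
    hyT (h ▸ Subgroup.mem_sup_right (Subgroup.mem_zpowers y))
  refine hsuper.product G T (Subgroup.zpowers y) (fun g => ?_)
    (isFSubnormal_of_commutator_le hform hsub hnil hcT) (h _ hy) hTmem (mem_of_isCyclic hnil hy.1)
  obtain ⟨a, ha, b, hb, hab⟩ := Subgroup.mem_sup_of_normal_left.1 (hsup ▸ Subgroup.mem_top g)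
  exact ⟨a, ha, b, hb, hab.symm⟩

theorem _root_.Subgroup.card_dvd_card_mul_card_of_sup_eq_top {H N : Subgroup G} [N.Normal]
    (h : H ⊔ N = ⊤) : Nat.card G ∣ Nat.card H * Nat.card N := by
  have hidx : N.index = N.relIndex H := by
    rw [← Subgroup.relIndex_sup_right, h, Subgroup.relIndex_top_right]
  rw [← N.index_mul_card, hidx]
  exact mul_dvd_mul_right (N.relIndex_dvd_card H) _

/-! ### Sylow subgroups with a normal complement -/

/-- In the application `a` is the order of a Sylow subgroup complementing `G'`. If `H ≤ K ⋖ L`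
and `L ⧸ K_L` were in the class, then `K_L ∩ G'` would have a supplement in `L` lying in the
class; by `hmax` its order would be `a`, so `|L|` would divide `a * |K_L ∩ G'|`, which divides
`|K|`. -/
theorem isFAbnormal_of_dvd_card [Finite G] (hform : 𝔉.IsFormation) (hsub : 𝔉.SubgroupClosed)
    (hsat : 𝔉.Saturated) (hnil : 𝔉.ContainsNilpotent) {a : ℕ}
    (hcop : a.Coprime (Nat.card (commutator G)))
    (hmax : ∀ Y : Subgroup G, 𝔉 Y → a ∣ Nat.card Y → Nat.card Y = a)
    {H : Subgroup G} (hH : a ∣ Nat.card H) : 𝔉.IsFAbnormal H := by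
  intro K L hHK hKL hF
  have haK : a ∣ Nat.card K := hH.trans (Subgroup.card_dvd_of_le hHK)
  have hab : 𝔉 (L ⧸ (commutator G).subgroupOf L) := by
    refine quotient_mem_of_ker_le hform hsub (abelianization_mem hnil G)
      (Abelianization.of.comp L.subtype) _ fun l hl => ?_
    rw [Subgroup.mem_subgroupOf, ← Abelianization.ker_of]
    exact hl
  set R := (K.subgroupOf L).normalCore ⊓ (commutator G).subgroupOf L with hR
  obtain ⟨Y, hY, hYR⟩ := exists_supplement_mem hform hsub hsat R (hform.subdirect L _ _ hF hab)
  have hRc : a.Coprime (Nat.card R) := by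
    refine hcop.coprime_dvd_right ?_
    rw [← Subgroup.card_map_of_injective L.subtype_injective]
    refine Subgroup.card_dvd_of_le ?_
    rintro _ ⟨r, hr, rfl⟩
    exact hr.2
  have hLdvd := Subgroup.card_dvd_card_mul_card_of_sup_eq_top hYR
  have haY : a ∣ Nat.card Y :=
    hRc.dvd_of_dvd_mul_right ((haK.trans (Subgroup.card_dvd_of_le hKL.le)).trans hLdvd)
  have hcY : Nat.card Y = a := by
    rw [← Subgroup.card_map_of_injective L.subtype_injective] at haY ⊢
    exact hmax _ (map_mem hform L.subtype_injective hY) haY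
  have hRK : Nat.card R ∣ Nat.card K := by
    rw [← Nat.card_congr (Subgroup.subgroupOfEquivOfLe hKL.le).toEquiv]
    exact Subgroup.card_dvd_of_le (inf_le_left.trans (Subgroup.normalCore_le _))
  rw [hcY] at hLdvd
  have hLK : Nat.card L ∣ Nat.card K := hLdvd.trans (hRc.mul_dvd_of_dvd_of_dvd haK hRK)
  exact hKL.ne (Subgroup.eq_of_le_of_card_ge hKL.le (Nat.le_of_dvd Nat.card_pos hLK))

/-- A Sylow `p`-subgroup that is a projector is, up to conjugacy, the only subgroup in the class
whose order is divisible by the full power of `p` in `|G|`. Only maximality in `G` itself, that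
is, the case `N = 1` of the projector condition, is needed. -/
theorem IsProjector.card_eq [Finite G] (hform : 𝔉.IsFormation) {p : ℕ} [Fact p.Prime]
    (P : Sylow p G) (hP : 𝔉.IsProjector (P : Subgroup G)) {Y : Subgroup G} (hY : 𝔉 Y)
    (hdvd : Nat.card P ∣ Nat.card Y) : Nat.card Y = Nat.card P := by
  have hcP := P.card_eq_multiplicity
  obtain ⟨Q, hQ⟩ := Sylow.exists_subgroup_card_pow_prime p (hcP ▸ hdvd)
  have hQc : Nat.card (Q.map Y.subtype) = p ^ (Nat.card G).factorization p := by
    rw [Subgroup.card_map_of_injective Y.subtype_injective, hQ]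
  obtain ⟨g, hg⟩ := MulAction.exists_smul_eq G (Sylow.ofCard _ hQc) P
  set c : G →* G := (MulAut.conj g).toMonoidHom with hc
  have hcinj : Function.Injective c := (MulAut.conj g).injective
  have hPY : (P : Subgroup G) ≤ Y.map c := by
    rw [← hg]
    exact Subgroup.map_mono (Subgroup.map_subtype_le Q)
  have hinj : Function.Injective (QuotientGroup.mk' (⊥ : Subgroup G)) := by
    rw [← MonoidHom.ker_eq_bot_iff, QuotientGroup.ker_mk']
  have hle := (hP ⊥).le_of_ge (map_mem hform hinj (map_mem hform hcinj hY))
    (Subgroup.map_mono hPY)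
  have heq := le_antisymm hPY ((Subgroup.map_le_map_iff_of_injective hinj).1 hle)
  have : Nat.card (Y.map c) = Nat.card Y := Subgroup.card_map_of_injective hcinj
  rw [← heq] at this
  exact this.symm

/-! ### The equivalence -/

/-- The conditions imposed on the generator `x` of a Sylow `p`-subgroup in the third statement
of the equivalence. -/
def IsSplitting (𝔉 : GroupClass.{u}) (p : ℕ) (x : G) : Prop :=
  p.Prime ∧ p ∣ Nat.card G ∧
    (commutator G).IsInternalSemidirect (Subgroup.zpowers x) ∧
    (∃ P : Sylow p G, (P : Subgroup G) = Subgroup.zpowers x) ∧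
    𝔉.IsProjector (Subgroup.zpowers x) ∧
    commutator G = 𝔉.residual G ∧
    𝔉 (commutator G ⊔ Subgroup.zpowers (x ^ p) : Subgroup G)

theorem IsSplitting.isFSubnormal_or_isFAbnormal [Finite G] (hform : 𝔉.IsFormation)
    (hsub : 𝔉.SubgroupClosed) (hsat : 𝔉.Saturated) (hnil : 𝔉.ContainsNilpotent)
    {p : ℕ} {x : G} (h : 𝔉.IsSplitting p x) (H : Subgroup G) :
    𝔉.IsFSubnormal H ∨ 𝔉.IsFAbnormal H := by
  obtain ⟨hp, -, ⟨-, hcompl⟩, ⟨P, hP⟩, hproj, -, hM⟩ := h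
  have := Fact.mk hp
  rw [← hP] at hcompl hproj
  by_cases hHM : H ≤ commutator G ⊔ Subgroup.zpowers (x ^ p)
  · exact .inl ((reflTransGen_of_mem hform hsub hHM hM).trans
      (isFSubnormal_of_commutator_le hform hsub hnil le_sup_left))
  · right
    have hcop : (Nat.card P).Coprime (Nat.card (commutator G)) := by
      rw [← hcompl.index_eq_card]
      exact P.card_coprime_index
    refine isFAbnormal_of_dvd_card hform hsub hsat hnil hcop
      (fun Y => IsProjector.card_eq hform P hproj) ?_
    -- An element of `H` outside `G'⟨x ^ p⟩` is `c * x ^ k` with `c ∈ G'` and `p ∤ k`.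
    obtain ⟨h, hh, hhM⟩ := SetLike.not_le_iff_exists.1 hHM
    have hG : commutator G ⊔ Subgroup.zpowers x = ⊤ := hP ▸ hcompl.sup_eq_top
    obtain ⟨c, hc, y, ⟨k, rfl⟩, rfl⟩ :=
      Subgroup.mem_sup_of_normal_left.1 (hG ▸ Subgroup.mem_top h)
    have hpk : ¬ (p : ℤ) ∣ k := by
      rintro ⟨m, rfl⟩
      refine hhM (mul_mem (Subgroup.mem_sup_left hc) (Subgroup.mem_sup_right ⟨m, ?_⟩))
      simp only [zpow_mul, zpow_natCast]
    have hsup : H ⊔ commutator G = ⊤ := by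
      have hk : x ^ k ∈ H ⊔ commutator G := by
        have := mul_mem (Subgroup.mem_sup_right (inv_mem hc))
          (Subgroup.mem_sup_left (T := commutator G) hh)
        simpa using this
      refine top_le_iff.1 (hG ▸ sup_le le_sup_right (Subgroup.zpowers_le.2 ?_))
      obtain ⟨n, hn⟩ := IsPGroup.iff_card.1 P.2
      have hx : x ^ (p ^ n) = 1 := by
        rw [← orderOf_dvd_iff_pow_eq_one, ← Nat.card_zpowers, ← hP, ← hn]
      have hco : IsCoprime k ((p : ℤ) ^ n) :=
        ((Nat.prime_iff_prime_int.1 hp).coprime_iff_not_dvd.2 hpk).symm.pow_right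
      obtain ⟨u, v, huv⟩ := hco
      have : x = (x ^ k) ^ u := by
        rw [← zpow_mul, mul_comm k u]
        conv_lhs => rw [← zpow_one x, ← huv, zpow_add, zpow_mul' x v]
        rw [← Nat.cast_pow, zpow_natCast, hx, one_zpow, mul_one]
      rw [this]
      exact zpow_mem hk u
    exact hcop.dvd_of_dvd_mul_right ((Subgroup.card_subgroup_dvd_card _).trans
      (Subgroup.card_dvd_card_mul_card_of_sup_eq_top hsup))

/-- An `𝔉`-abnormal cyclic subgroup of prime power order is a self-normalizing Sylow subgroup,
so by Burnside's transfer theorem it has a normal complement, which is then `G'`. -/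
theorem exists_isSplitting [Finite G] (hform : 𝔉.IsFormation) (hsub : 𝔉.SubgroupClosed)
    (hsuper : 𝔉.IsSuperradical) (hnil : 𝔉.ContainsNilpotent) (hsol : Group.IsSolvable G)
    (hG : ¬ 𝔉 G)
    (h : ∀ H : Subgroup G, H.IsPrimaryCyclic → 𝔉.IsFSubnormal H ∨ 𝔉.IsFAbnormal H) :
    ∃ (p : ℕ) (x : G), 𝔉.IsSplitting p x := by
  obtain ⟨H, hH, hHs⟩ : ∃ H : Subgroup G, H.IsPrimaryCyclic ∧ ¬ 𝔉.IsFSubnormal H := by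
    by_contra! hcon
    exact hG (mem_of_forall_isFSubnormal hform hsub hsuper hnil hsol hcon)
  have hab := (h H hH).resolve_left hHs
  obtain ⟨hcyc, p, hp, n, hn⟩ := hH
  have := Fact.mk hp
  obtain ⟨x, rfl⟩ := H.isCyclic_iff_exists_zpowers_eq_top.1 hcyc
  have : Nontrivial G := by
    by_contra hG'
    have := not_nontrivial_iff_subsingleton.1 hG'
    exact hG (hnil G inferInstance)
  have hc : commutator G ≠ ⊤ := (Group.IsSolvable.commutator_lt_top_of_nontrivial G).ne
  have hsup := hab.commutator_sup_eq_top hform hsub hnil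
  obtain ⟨P, hxP⟩ := (IsPGroup.of_card hn).exists_le_sylow
  have hP : Subgroup.zpowers x = P :=
    hab.eq_of_mem hform hsub hxP (mem_of_isPGroup hnil P.2)
  have hpx : p ∣ orderOf x := by
    rw [← Nat.card_zpowers, hn]
    refine dvd_pow_self p ?_
    rintro rfl
    rw [pow_zero, Subgroup.card_eq_one] at hn
    rw [hn, sup_bot_eq] at hsup
    exact hc hsup
  have hnorm : Subgroup.normalizer (P : Set G) ≤ Subgroup.centralizer (P : Set G) := by
    have hle := hab.normalizer_le hform hsub hnil
    rw [hP] at hle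
    have hcent := Subgroup.le_centralizer (Subgroup.zpowers x)
    rw [hP] at hcent
    exact hle.trans hcent
  have hdisj : Disjoint (commutator G) (Subgroup.zpowers x) := by
    have hcompl : (MonoidHom.transferSylow P hnorm).ker.IsComplement' (Subgroup.zpowers x) :=
      hP.symm ▸ MonoidHom.ker_transferSylow_isComplement' P hnorm
    exact hcompl.disjoint.mono_left
      (Subgroup.Normal.commutator_le_of_self_sup_commutative_eq_top hcompl.sup_eq_top inferInstance)
  have hM : commutator G ⊔ Subgroup.zpowers (x ^ p) ≠ ⊤ := by
    intro htop
    obtain ⟨c, hc, y, ⟨k, rfl⟩, hxy⟩ :=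
      Subgroup.mem_sup_of_normal_left.1 (htop ▸ Subgroup.mem_top x)
    have hcx : c = x ^ (1 - p * k : ℤ) := by
      rw [eq_mul_inv_of_mul_eq hxy, zpow_sub, zpow_one, zpow_mul, zpow_natCast]
    have h1 : x ^ (1 - p * k : ℤ) = 1 := hcx ▸ Subgroup.disjoint_def.1 hdisj hc ⟨_, hcx.symm⟩
    have h2 : (p : ℤ) ∣ 1 - p * k :=
      (Int.natCast_dvd_natCast.2 hpx).trans (orderOf_dvd_iff_zpow_eq_one.2 h1)
    have h3 : (p : ℤ) ∣ 1 := by simpa using dvd_add h2 (dvd_mul_right (p : ℤ) k)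
    exact (Nat.prime_iff_prime_int.1 hp).not_dvd_one h3
  refine ⟨p, x, hp, hpx.trans (orderOf_dvd_natCard x), ⟨inferInstance, ?_⟩, ⟨P, hP.symm⟩,
    fun N _ => ⟨mem_of_isCyclic hnil ?_, fun Y hY hle => ?_⟩, le_antisymm (le_sInf ?_)
      (sInf_le ⟨inferInstance, abelianization_mem hnil G⟩), ?_⟩
  · refine Subgroup.isComplement'_of_disjoint_and_mul_eq_univ hdisj ?_
    rw [← Subgroup.normal_mul, hsup, Subgroup.coe_top]
  · rw [MonoidHom.map_zpowers]
    infer_instance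
  · -- Abnormality applies to the preimage of `Y` in `G`.
    have hle' := Subgroup.map_le_iff_le_comap.1 hle
    have key := hab.eq_of_ker_le hform hsub hY
      (K := (Subgroup.zpowers x ⊔ N)) (L := Y.comap (QuotientGroup.mk' N)) le_sup_left
      (sup_le hle' ?_) ((QuotientGroup.mk' N).subgroupComap Y) ?_
    · rw [← Subgroup.map_comap_eq_self_of_surjective (QuotientGroup.mk'_surjective N) Y, ← key,
        Subgroup.map_sup, QuotientGroup.map_mk'_self, sup_bot_eq]
    · exact fun g hg => by
        rw [Subgroup.mem_comap, QuotientGroup.mk'_apply, (QuotientGroup.eq_one_iff g).2 hg]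
        exact one_mem _
    · intro g hg
      exact Subgroup.mem_sup_right ((QuotientGroup.eq_one_iff _).1 (congrArg Subtype.val hg))
  · rintro N ⟨hN, hF⟩
    have := hab.eq_of_ker_le hform hsub hF (K := N ⊔ Subgroup.zpowers x) le_sup_right le_top
      ((QuotientGroup.mk' N).comp (⊤ : Subgroup G).subtype) fun g hg =>
        Subgroup.mem_sup_left ((QuotientGroup.eq_one_iff _).1 hg)
    exact Subgroup.Normal.commutator_le_of_self_sup_commutative_eq_top this inferInstance
  · -- No subgroup of `G'⟨x ^ p⟩` is abnormal, since it does not supplement `G'`.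
    set M := commutator G ⊔ Subgroup.zpowers (x ^ p)
    refine mem_of_forall_isFSubnormal hform hsub hsuper hnil inferInstance fun Z hZ => ?_
    have hZ' := (h _ (hZ.map M.subtype_injective)).resolve_right fun hZab =>
      hM <| top_le_iff.1 <| (hZab.commutator_sup_eq_top hform hsub hnil).ge.trans
        (sup_le le_sup_left (Subgroup.map_subtype_le Z))
    have := hZ'.comap hform hsub M.subtype
    rwa [Subgroup.comap_map_eq_self_of_injective M.subtype_injective] at this

end GroupClass

theorem mainTheorem2 (𝔉 : GroupClass.{u}) (hform : 𝔉.IsFormation)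
    (hsub : 𝔉.SubgroupClosed) (hsat : 𝔉.Saturated) (hsuper : 𝔉.IsSuperradical)
    (hnil : 𝔉.ContainsNilpotent)
    (G : Type u) [Group G] [Finite G] (hsol : Group.IsSolvable G) (hG : ¬ 𝔉 G) :
    List.TFAE [
      ∀ H : Subgroup G, H.IsPrimaryCyclic → 𝔉.IsFSubnormal H ∨ 𝔉.IsFAbnormal H,
      ∀ H : Subgroup G, H ≠ ⊤ → 𝔉.IsFSubnormal H ∨ 𝔉.IsFAbnormal H,
      ∃ (p : ℕ) (x : G), p.Prime ∧ p ∣ Nat.card G ∧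
        (commutator G).IsInternalSemidirect (Subgroup.zpowers x) ∧
        (∃ P : Sylow p G, (P : Subgroup G) = Subgroup.zpowers x) ∧
        𝔉.IsProjector (Subgroup.zpowers x) ∧
        commutator G = 𝔉.residual G ∧
        𝔉 (commutator G ⊔ Subgroup.zpowers (x ^ p) : Subgroup G)] := by
  tfae_have 1 → 3 := GroupClass.exists_isSplitting hform hsub hsuper hnil hsol hG
  tfae_have 3 → 2 := fun ⟨_, _, h⟩ H _ =>
    GroupClass.IsSplitting.isFSubnormal_or_isFAbnormal hform hsub hsat hnil h H
  tfae_have 2 → 1 := fun h H _ => by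
    by_cases hH : H = ⊤
    · exact .inl (hH ▸ .refl)
    · exact h H hH
  tfae_finish
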